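/- Let $K$ be a number field with ring of integers $\mathfrak o_K$, and let $R$ be a number ring in $K$, i.e. a subring of $K$ whose field of fractions is $K$. Let $\mathscr O$ be the integral closure of $R$ in $K$, put $\mathfrak o=R\cap\mathfrak o_K$, and let $T$ be the set of nonzero prime ideals $\mathfrak p$ of $\mathfrak o_K$ such that $\mathrm{ord}_{\mathfrak p}(x)<0$ for some $x\in R$. Put $\mathfrak o_{K,T}=\{x\in K:\mathrm{ord}_{\mathfrak p}(x)\ge 0\text{ for all }\mathfrak p\notin T\}$; a $T$-unit is an element $x \in K^*$ with $\mathrm{ord}_{\mathfrak p}(x)=0$ for all $\mathfrak p\notin T$. For a subring $A$ of $K$ with integral closure $A'$ in $K$, the conductor of $A$ is $\{x\in K: xA'\subseteq A\}$; let $\mathfrak f$ and $\mathfrak f_{\mathfrak o}$ be the conductors of $R$ and of $\mathfrak o$. Suppose that $T$ is finite. Then $\mathscr O=\mathfrak o_{K,T}$, and there is a $T$-unit $\epsilon\in\mathfrak o$ such that $R$ is the localization $\mathfrak o[1/\epsilon]$ of $\mathfrak o$ at the set of powers of $\epsilon$ and $\mathfrak o_{K,T}$ is the localization $\mathfrak o_K[1/\epsilon]$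 of $\mathfrak o_K$ at the set of powers of $\epsilon$. Moreover $\mathfrak f_{\mathfrak o}=\mathfrak f\cap\mathfrak o_K$ and $\mathfrak f=\mathfrak f_{\mathfrak o}\,\mathfrak o_{K,T}$ (the $\mathfrak o_{K,T}$-submodule of $K$ generated by $\mathfrak f_{\mathfrak o}$). -/

import Mathlib

open NumberField IsDedekindDomain

namespace NumberRing

variable {K : Type*} [Field K]

/-- The conductor `{x ∈ K | x 𝒪 ⊆ R}` of a subring `R` of `K`, where `𝒪` is the integral closure
of `R` in `K`. -/
def conductor (R : Subring K) : Set K :=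
  {x : K | ∀ y ∈ integralClosure R K, x * y ∈ R}

/-- The subring `𝔬 = R ∩ 𝔬_K` of `K`. -/
def integralPart (R : Subring K) : Subring K :=
  R ⊓ (integralClosure ℤ K).toSubring

/-- `R` is an algebra over `R ∩ 𝔬_K` through the inclusion. -/
instance (R : Subring K) : Algebra (integralPart R) R :=
  (Subring.inclusion (inf_le_left : integralPart R ≤ R)).toAlgebra

/-- The inclusion of `R ∩ 𝔬_K` into `𝔬_K`. -/
def integralPartInclusion (R : Subring K) : integralPart R →+* 𝓞 K :=
  Subring.inclusion (inf_le_right : integralPart R ≤ (integralClosure ℤ K).toSubring)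

/-- The set of the nonzero prime ideals `𝔭` of `𝔬_K` such that `ord_𝔭(x) < 0` for some `x ∈ R`.
The valuation is written multiplicatively, so `ord_𝔭(x) < 0` reads `1 < v_𝔭(x)`. -/
def associatedSet [NumberField K] (R : Subring K) : Set (HeightOneSpectrum (𝓞 K)) :=
  {p | ∃ x ∈ R, 1 < p.valuation K x}

end NumberRing

/-! Everything follows from one `ε ∈ 𝔬` that is a unit of `R` and vanishes exactly on `T`: each `y ∈
𝔬_{K,T}` is then `a / ε ^ n` with `a ∈ 𝔬_K`, and `ε ^ n` moves freely in and out of `R` and its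
conductor. Finiteness of the class group gives `e ∈ 𝔬_K` with zero set `T`. A pole at `p` forces `p
S = S` for `S = R 𝔬_K`, so `e` is a unit of `S`. As `m S ⊆ R` for some integer `m ≠ 0` and `𝔬_K / m`
is finite, a power of `e` is a unit of `R` itself (`exists_mem_inv_mem_iff_mem_associatedSet`). -/

namespace IsDedekindDomain.HeightOneSpectrum

/-! ### Zeros and poles at finitely many primes of a Dedekind domain. -/

variable {A : Type*} [CommRing A] [IsDedekindDomain A] {K : Type*} [Field K] [Algebra A K]
  [IsFractionRing A K]

/-- A nonzero prime becomes the unit ideal in an overring that has an element with a pole at it. -/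
theorem map_asIdeal_eq_top_of_one_lt_valuation (p : HeightOneSpectrum A) (S : Subalgebra A K)
    {x : K} (hxS : x ∈ S) (hx : 1 < p.valuation K x) :
    p.asIdeal.map (algebraMap A S) = ⊤ := by
  obtain ⟨n, d, h | h⟩ := p.exists_primeCompl_mul_eq_or_mul_eq x
  · have hd := (p.valuation_eq_one_iff_notMem (K := K)).mpr d.2
    have h1 : p.valuation K (algebraMap A K n) ≤ 1 := p.valuation_le_one n
    rw [← h, map_mul, hd, mul_one] at h1
    exact absurd h1 (not_le.mpr hx)
  · have hd := (p.valuation_eq_one_iff_notMem (K := K)).mpr d.2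
    have hn : n ∈ p.asIdeal := by
      by_contra hn
      have hn := (p.valuation_eq_one_iff_notMem (K := K)).mpr hn
      rw [← h, map_mul, hn, mul_one] at hd
      exact hx.ne' hd
    -- Since `d = x n` with `n ∈ p`, the element `d ∉ p` lies in `p S`; it is invertible modulo `p`,
    -- so `1 ∈ p S`.
    have hdmap : algebraMap A S d ∈ p.asIdeal.map (algebraMap A S) := by
      have : algebraMap A S d = ⟨x, hxS⟩ * algebraMap A S n := Subtype.ext h.symm
      rw [this]
      exact Ideal.mul_mem_left _ _ (Ideal.mem_map_of_mem _ hn)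
    obtain ⟨b, i, hi, hb⟩ := p.isMaximal.exists_inv d.2
    rw [Ideal.eq_top_iff_one, ← map_one (algebraMap A S), ← hb, map_add, map_mul]
    exact add_mem (Ideal.mul_mem_left _ _ hdmap) (Ideal.mem_map_of_mem _ hi)

theorem exists_pow_asIdeal_eq_span_singleton [Finite (ClassGroup A)] (p : HeightOneSpectrum A) :
    ∃ n ≠ 0, ∃ a : A, p.asIdeal ^ n = Ideal.span {a} := by
  have hp : p.asIdeal ∈ nonZeroDivisors (Ideal A) := mem_nonZeroDivisors_of_ne_zero p.ne_bot
  obtain ⟨n, hn, h⟩ : ∃ n ≠ 0, ClassGroup.mk0 ⟨p.asIdeal, hp⟩ ^ n = 1 :=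
    ⟨Nat.card (ClassGroup A), Nat.card_pos.ne', pow_card_eq_one'⟩
  rw [← map_pow, SubmonoidClass.mk_pow, ClassGroup.mk0_eq_one_iff] at h
  exact ⟨n, hn, h.principal⟩

/-- An element whose zeros are exactly the primes of a given finite set, and which becomes a unit
in every overring that has poles at all of these primes. -/
theorem exists_valuation_lt_one_iff_mem [Finite (ClassGroup A)] {T : Set (HeightOneSpectrum A)}
    (hT : T.Finite) : ∃ e : A, e ≠ 0 ∧
      (∀ p : HeightOneSpectrum A, e ∈ p.asIdeal ↔ p ∈ T) ∧
      ∀ S : Subalgebra A K, (∀ p ∈ T, ∃ x ∈ S, 1 < p.valuation K x) →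
        (algebraMap A K e)⁻¹ ∈ S := by
  choose n hn a ha using exists_pow_asIdeal_eq_span_singleton (A := A)
  have ha0 (p : HeightOneSpectrum A) : a p ≠ 0 := fun h ↦
    pow_ne_zero (n p) p.ne_bot (by rw [ha, h, Ideal.span_singleton_eq_bot.mpr rfl]; rfl)
  have hmem (p q : HeightOneSpectrum A) : a q ∈ p.asIdeal ↔ p = q := by
    rw [← Ideal.span_singleton_le_iff_mem, ← ha, p.isPrime.pow_le_iff (hn q)]
    refine ⟨fun h ↦ HeightOneSpectrum.ext ?_, fun h ↦ h ▸ le_rfl⟩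
    exact (q.isMaximal.eq_of_le p.isPrime.ne_top h).symm
  refine ⟨∏ p ∈ hT.toFinset, a p, Finset.prod_ne_zero_iff.mpr fun p _ ↦ ha0 p, fun p ↦ ?_,
    fun S hS ↦ ?_⟩
  · simp [p.isPrime.prod_mem_iff, hmem]
  · rw [map_prod, ← Finset.prod_inv_distrib]
    refine prod_mem fun p hp ↦ ?_
    obtain ⟨x, hxS, hx⟩ := hS p (hT.mem_toFinset.mp hp)
    have h := p.map_asIdeal_eq_top_of_one_lt_valuation S hxS hx
    -- `(a p) S = (p S) ^ n = S`, so `a p` is a unit of `S`.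
    have h2 : Ideal.span {algebraMap A S (a p)} = ⊤ := by
      rw [← Set.image_singleton, ← Ideal.map_span, ← ha, Ideal.map_pow, h, Ideal.top_pow]
    obtain ⟨b, hb⟩ := (Ideal.span_singleton_eq_top.mp h2).exists_right_inv
    have hb' : algebraMap A K (a p) * b = 1 := congrArg Subtype.val hb
    rw [inv_eq_of_mul_eq_one_right hb']
    exact b.2

theorem exists_mul_pow_eq_algebraMap {T : Set (HeightOneSpectrum A)} (hT : T.Finite) {e : A}
    (he : ∀ p ∈ T, e ∈ p.asIdeal) {y : K} (hy : y ∈ T.integer K) :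
    ∃ (n : ℕ) (a : A), y * algebraMap A K e ^ n = algebraMap A K a := by
  have key (p : HeightOneSpectrum A) : ∃ n : ℕ, p ∈ T →
      p.valuation K y * p.valuation K (algebraMap A K e) ^ n ≤ 1 := by
    by_cases hp : p ∈ T
    · obtain rfl | hy0 := eq_or_ne y 0
      · exact ⟨0, by simp⟩
      have hv : p.valuation K y ≠ 0 := (Valuation.ne_zero_iff _).mpr hy0
      obtain ⟨n, hn⟩ := exists_pow_lt₀ (show p.valuation K (algebraMap A K e) < 1 from
        (p.valuation_lt_one_iff_mem (K := K) e).mpr (he p hp))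
        (Units.mk0 _ (inv_ne_zero hv))
      refine ⟨n, fun _ ↦ ?_⟩
      calc _ ≤ p.valuation K y * (p.valuation K y)⁻¹ := mul_le_mul_right hn.le _
        _ = 1 := mul_inv_cancel₀ hv
    · exact ⟨0, fun h ↦ absurd h hp⟩
  choose n hn using key
  -- The sum dominates every `n p`, and since `e` is integral a larger exponent does no harm.
  refine ⟨∑ p ∈ hT.toFinset, n p, ?_⟩
  suffices h : ∀ p : HeightOneSpectrum A,
      p.valuation K (y * algebraMap A K e ^ ∑ p ∈ hT.toFinset, n p) ≤ 1 by
    obtain ⟨a, ha⟩ := mem_integers_of_valuation_le_one K _ h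
    exact ⟨a, ha.symm⟩
  intro p
  rw [map_mul, map_pow]
  by_cases hp : p ∈ T
  · refine le_trans (mul_le_mul_right (pow_le_pow_right_of_le_one' ?_ ?_) _) (hn p hp)
    · exact p.valuation_le_one e
    · exact Finset.single_le_sum (fun _ _ ↦ Nat.zero_le _) (hT.mem_toFinset.mpr hp)
  · exact mul_le_one' (hy p hp) (pow_le_one' (p.valuation_le_one e) _)

end IsDedekindDomain.HeightOneSpectrum

/-! ### Denominators in a number ring, and a unit supported on `T`. -/

namespace NumberRing

variable {K : Type*} [Field K]

/-- The denominator of `x` is algebraic over `ℤ`, so it divides a nonzero integer inside `R`. -/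
theorem exists_intCast_mul_mem [NumberField K] (R : Subring K) [IsFractionRing R K] (x : K) :
    ∃ m : ℤ, m ≠ 0 ∧ (m : K) * x ∈ R := by
  obtain ⟨r, s, hs, rfl⟩ := IsFractionRing.div_surjective (A := R) x
  have halg : IsAlgebraic ℤ s := by
    rw [← isAlgebraic_algebraMap_iff (A := K) Subtype.val_injective]
    exact (IsFractionRing.isAlgebraic_iff ℤ ℚ K).mpr (Algebra.IsAlgebraic.isAlgebraic _)
  obtain ⟨m, hm, t, ht⟩ := halg.exists_nonzero_dvd hs
  refine ⟨m, hm, ?_⟩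
  have hs0 : (s : K) ≠ 0 := fun h ↦ nonZeroDivisors.ne_zero hs (Subtype.ext h)
  have hmK : (m : K) = s * t := by simpa using congrArg Subtype.val ht
  have : (m : K) * (algebraMap R K r / algebraMap R K s) = r * t := by
    rw [hmK]
    change (s : K) * t * (r / s) = r * t
    field_simp
  rw [this]
  exact mul_mem r.2 t.2

/-- `R ∩ 𝔬_K` has finite index in `𝔬_K`. -/
theorem exists_intCast_mul_algebraMap_mem [NumberField K] (R : Subring K) [IsFractionRing R K] :
    ∃ m : ℤ, m ≠ 0 ∧ ∀ a : 𝓞 K, (m : K) * algebraMap (𝓞 K) K a ∈ R := by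
  have b := RingOfIntegers.basis K
  choose m hm hmR using fun i ↦ exists_intCast_mul_mem R (algebraMap (𝓞 K) K (b i))
  refine ⟨∏ i, m i, Finset.prod_ne_zero_iff.mpr fun i _ ↦ hm i, fun a ↦ ?_⟩
  rw [← b.sum_repr a, map_sum, Finset.mul_sum]
  refine sum_mem fun i hi ↦ ?_
  obtain ⟨c, hc⟩ := Finset.dvd_prod_of_mem m hi
  have : ((∏ i, m i : ℤ) : K) * algebraMap (𝓞 K) K (b.repr a i • b i) =
      ((c * b.repr a i : ℤ) : K) * ((m i : K) * algebraMap (𝓞 K) K (b i)) := by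
    rw [hc, map_zsmul, zsmul_eq_mul]
    push_cast
    ring
  rw [this]
  exact mul_mem (intCast_mem R _) (hmR i)

/-- The subring `R 𝔬_K` of `K`, as an algebra over `𝔬_K`. -/
def compositum (R : Subring K) : Subalgebra (𝓞 K) K where
  __ := Algebra.adjoin R (Set.range (algebraMap (𝓞 K) K))
  algebraMap_mem' a := Algebra.subset_adjoin ⟨a, rfl⟩

theorem le_compositum (R : Subring K) {x : K} (hx : x ∈ R) : x ∈ compositum R :=
  (Algebra.adjoin R (Set.range (algebraMap (𝓞 K) K))).algebraMap_mem ⟨x, hx⟩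

theorem isIntegral_algebraMap (R : Subring K) (a : 𝓞 K) :
    IsIntegral R (algebraMap (𝓞 K) K a) :=
  (RingOfIntegers.isIntegral_coe a).tower_top

theorem compositum_le_integralClosure (R : Subring K) {x : K} (hx : x ∈ compositum R) :
    x ∈ integralClosure R K := by
  have : Algebra.adjoin R (Set.range (algebraMap (𝓞 K) K)) ≤ integralClosure R K :=
    Algebra.adjoin_le (by rintro _ ⟨a, rfl⟩; exact isIntegral_algebraMap R a)
  exact this hx

/-- `𝔬_K` is closed under products, so it spans `R 𝔬_K` as an `R`-module. -/
theorem intCast_mul_mem_of_mem_compositum (R : Subring K) {m : ℤ}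
    (hm : ∀ a : 𝓞 K, (m : K) * algebraMap (𝓞 K) K a ∈ R) {x : K} (hx : x ∈ compositum R) :
    (m : K) * x ∈ R := by
  have hx' : x ∈ Submodule.span R (Set.range (algebraMap (𝓞 K) K)) := by
    have h : x ∈ Subalgebra.toSubmodule
        (Algebra.adjoin R (Set.range (algebraMap (𝓞 K) K))) := hx
    rw [Algebra.adjoin_eq_span] at h
    have hcl : Submonoid.closure (Set.range (algebraMap (𝓞 K) K)) ≤
        MonoidHom.mrange (algebraMap (𝓞 K) K : 𝓞 K →* K) :=
      Submonoid.closure_le.mpr (by rintro _ ⟨a, rfl⟩; exact ⟨a, rfl⟩)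
    exact Submodule.span_mono hcl h
  clear hx
  induction hx' using Submodule.span_induction with
  | mem x h => obtain ⟨a, rfl⟩ := h; exact hm a
  | zero => simp
  | add x y _ _ hx hy => rw [mul_add]; exact add_mem hx hy
  | smul r x _ hx =>
    have : (m : K) * (r • x) = r * (m * x) := by rw [Subring.smul_def, smul_eq_mul]; ring
    rw [this]; exact mul_mem r.2 hx

/-- For `p ∉ T` the valuation ring of `p` contains `R` and is integrally closed. -/
theorem mem_integer_of_mem_integralClosure [NumberField K] {R : Subring K} {x : K} (hx : x ∈ integralClosure R K) :
    x ∈ (associatedSet R).integer K := by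
  intro p hp
  have hR : ∀ r : R, p.valuation K r ≤ 1 := fun r ↦ not_lt.mp fun h ↦ hp ⟨r, r.2, h⟩
  let f : R →+* (p.valuation K).integer := Subring.inclusion (fun r hr ↦ hR ⟨r, hr⟩)
  obtain ⟨P, hP, hPx⟩ := hx
  refine (Valuation.integer.integers (p.valuation K)).mem_of_integral (x := x) ?_
  exact ⟨P.map f, hP.map f, by rw [Polynomial.eval₂_map]; exact hPx⟩

/-- A nonzero element of `𝔬_K` that is a unit of `R` and whose zeros are exactly the primes
at which `R` has poles. -/
theorem exists_mem_inv_mem_iff_mem_associatedSet [NumberField K] (R : Subring K)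
    [IsFractionRing R K] (hfin : (associatedSet R).Finite) :
    ∃ e : 𝓞 K, e ≠ 0 ∧
      (∀ p : HeightOneSpectrum (𝓞 K), e ∈ p.asIdeal ↔ p ∈ associatedSet R) ∧
      algebraMap (𝓞 K) K e ∈ R ∧ (algebraMap (𝓞 K) K e)⁻¹ ∈ R := by
  obtain ⟨e, he0, he, heS⟩ := HeightOneSpectrum.exists_valuation_lt_one_iff_mem (K := K) hfin
  have heinv := heS (compositum R) fun p ⟨x, hxR, hx⟩ ↦ ⟨x, le_compositum R hxR, hx⟩
  obtain ⟨m, hm0, hm⟩ := exists_intCast_mul_algebraMap_mem R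
  have hI : Ideal.span {(m : 𝓞 K)} ≠ ⊥ := by
    simpa [Ideal.span_singleton_eq_bot] using hm0
  have : Finite (𝓞 K ⧸ Ideal.span {(m : 𝓞 K)}) := Ideal.finiteQuotientOfFreeOfNeBot _ hI
  obtain ⟨i, j, hij, h⟩ : ∃ i j : ℕ, i < j ∧
      Ideal.Quotient.mk (Ideal.span {(m : 𝓞 K)}) (e ^ j) = Ideal.Quotient.mk _ (e ^ i) := by
    obtain ⟨i, j, hne, h⟩ := Finite.exists_ne_map_eq_of_infinite
      fun n : ℕ ↦ Ideal.Quotient.mk (Ideal.span {(m : 𝓞 K)}) (e ^ n)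
    rcases hne.lt_or_gt with hlt | hlt
    · exact ⟨i, j, hlt, h.symm⟩
    · exact ⟨j, i, hlt, h⟩
  obtain ⟨c, hc⟩ := Ideal.mem_span_singleton.mp (Ideal.Quotient.eq.mp h)
  obtain ⟨k, rfl⟩ := Nat.exists_eq_add_of_lt hij
  have hE0 : algebraMap (𝓞 K) K e ≠ 0 :=
    (map_ne_zero_iff _ (FaithfulSMul.algebraMap_injective (𝓞 K) K)).mpr he0
  have hcK := congrArg (algebraMap (𝓞 K) K) hc
  simp only [map_sub, map_pow, map_mul, map_intCast] at hcK
  -- With `e ^ j - e ^ i = m c`, dividing by `e ^ i` and by `e ^ j` stays in `m S ⊆ R`; this puts `e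
  -- ^ (j - i) - 1` and `1 - e ^ (i - j)` in `R`.
  have hmul (n : ℕ) :
      (m : K) * (algebraMap (𝓞 K) K c * (algebraMap (𝓞 K) K e)⁻¹ ^ n) ∈ R :=
    intCast_mul_mem_of_mem_compositum R hm
      (mul_mem ((compositum R).algebraMap_mem c) (pow_mem heinv n))
  refine ⟨e ^ (k + 1), pow_ne_zero _ he0, fun p ↦ ?_, ?_, ?_⟩
  · rw [p.isPrime.pow_mem_iff_mem _ k.succ_pos, he]
  · have h1 := add_mem (one_mem R) (hmul i)
    rwa [← mul_assoc, ← hcK, show (1 : K) + (algebraMap (𝓞 K) K e ^ (i + k + 1) -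
      algebraMap (𝓞 K) K e ^ i) * (algebraMap (𝓞 K) K e)⁻¹ ^ i =
      algebraMap (𝓞 K) K (e ^ (k + 1)) by
        rw [map_pow, inv_pow]; field_simp; ring] at h1
  · have h1 := sub_mem (one_mem R) (hmul (i + k + 1))
    rwa [← mul_assoc, ← hcK, show (1 : K) - (algebraMap (𝓞 K) K e ^ (i + k + 1) -
      algebraMap (𝓞 K) K e ^ i) * (algebraMap (𝓞 K) K e)⁻¹ ^ (i + k + 1) =
      (algebraMap (𝓞 K) K (e ^ (k + 1)))⁻¹ by
        rw [map_pow, inv_pow]; field_simp; ring] at h1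

theorem mem_integralClosure_integralPart_iff (R : Subring K) {x : K} :
    x ∈ integralClosure (integralPart R) K ↔ x ∈ integralClosure ℤ K := by
  refine ⟨fun ⟨P, hP, hx⟩ ↦ ?_, fun h ↦ IsIntegral.tower_top h⟩
  let f : integralPart R →+* integralClosure ℤ K :=
    Subring.inclusion (inf_le_right : integralPart R ≤ (integralClosure ℤ K).toSubring)
  have h : IsIntegral (integralClosure ℤ K) x :=
    ⟨P.map f, hP.map f, by rw [Polynomial.eval₂_map]; exact hx⟩
  exact isIntegral_trans x h

end NumberRing

theorem mainTheorem9 {K : Type*} [Field K] [NumberField K] (R : Subring K) [IsFractionRing R K]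
    (T : Set (HeightOneSpectrum (𝓞 K))) (hT : T = NumberRing.associatedSet R)
    (hfin : T.Finite) :
    (integralClosure R K : Set K) = (T.integer K : Set K) ∧
    (∃ ε : NumberRing.integralPart R,
      (∃ u ∈ T.unit K, (u : K) = (ε : K)) ∧
      IsLocalization.Away ε R ∧
      IsLocalization.Away (NumberRing.integralPartInclusion R ε) (T.integer K)) ∧
    NumberRing.conductor (NumberRing.integralPart R) =
      NumberRing.conductor R ∩ Set.range (algebraMap (𝓞 K) K) ∧
    NumberRing.conductor R =
      (Submodule.span (T.integer K) (NumberRing.conductor (NumberRing.integralPart R)) : Set K) := by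
  subst hT
  obtain ⟨e, he0, he, heR, heinv⟩ :=
    NumberRing.exists_mem_inv_mem_iff_mem_associatedSet R hfin
  have hE0 : algebraMap (𝓞 K) K e ≠ 0 :=
    (map_ne_zero_iff _ (FaithfulSMul.algebraMap_injective (𝓞 K) K)).mpr he0
  have hRT {x : K} (hx : x ∈ R) : x ∈ (NumberRing.associatedSet R).integer K :=
    fun p hp ↦ not_lt.mp fun h ↦ hp ⟨x, hx, h⟩
  have hden {y : K} (hy : y ∈ (NumberRing.associatedSet R).integer K) :
      ∃ (n : ℕ) (a : 𝓞 K), y * algebraMap (𝓞 K) K e ^ n = algebraMap (𝓞 K) K a :=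
    HeightOneSpectrum.exists_mul_pow_eq_algebraMap hfin (fun p hp ↦ (he p).mpr hp) hy
  have hTO {y : K} (hy : y ∈ (NumberRing.associatedSet R).integer K) :
      y ∈ integralClosure R K := by
    obtain ⟨n, a, h⟩ := hden hy
    rw [(eq_mul_inv_iff_mul_eq₀ (pow_ne_zero n hE0)).mpr h, ← inv_pow]
    exact mul_mem (NumberRing.isIntegral_algebraMap R a)
      ((integralClosure R K).algebraMap_mem ⟨_, pow_mem heinv n⟩)
  have hOT : (integralClosure R K : Set K) = ((NumberRing.associatedSet R).integer K : Set K) :=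
    Set.Subset.antisymm (fun _ ↦ NumberRing.mem_integer_of_mem_integralClosure) fun _ ↦ hTO
  have hcond : NumberRing.conductor (NumberRing.integralPart R) =
      NumberRing.conductor R ∩ Set.range (algebraMap (𝓞 K) K) := by
    ext x
    constructor
    · intro hx
      have hx1 : x ∈ NumberRing.integralPart R := by simpa using hx 1 (one_mem _)
      refine ⟨fun y hy ↦ ?_, ⟨x, hx1.2⟩, rfl⟩
      -- `y = a ε⁻ⁿ` with `x a ∈ 𝔬`, and `ε⁻ⁿ ∈ R`.
      obtain ⟨n, a, h⟩ := hden (NumberRing.mem_integer_of_mem_integralClosure hy)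
      rw [(eq_mul_inv_iff_mul_eq₀ (pow_ne_zero n hE0)).mpr h, ← inv_pow, ← mul_assoc]
      exact mul_mem (hx _ ((NumberRing.mem_integralClosure_integralPart_iff R).mpr a.2)).1
        (pow_mem heinv n)
    · rintro ⟨hx, a, rfl⟩ y hy
      rw [NumberRing.mem_integralClosure_integralPart_iff] at hy
      exact ⟨hx y hy.tower_top, mul_mem a.2 hy⟩
  refine ⟨hOT, ⟨⟨algebraMap (𝓞 K) K e, heR, e.2⟩, ⟨Units.mk0 _ hE0, fun p hp ↦ ?_, rfl⟩, ?_, ?_⟩,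
    hcond, ?_⟩
  · exact p.valuation_eq_one_iff_notMem.mpr fun h ↦ hp ((he p).mp h)
  · refine IsLocalization.Away.mk _ ?_ (fun s ↦ ?_) fun a b h ↦ ⟨0, ?_⟩
    · exact IsUnit.of_mul_eq_one ⟨_, heinv⟩ (Subtype.ext (mul_inv_cancel₀ hE0))
    · obtain ⟨n, a, h⟩ := hden (hRT s.2)
      exact ⟨n, ⟨algebraMap (𝓞 K) K a, h ▸ mul_mem s.2 (pow_mem heR n), a.2⟩, Subtype.ext h⟩
    · have hab : (a : K) = b := congrArg (fun r : R ↦ (r : K)) h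
      rw [Subtype.ext hab]
  · change IsLocalization.Away e _
    refine IsLocalization.Away.mk _ ?_ (fun s ↦ ?_) fun a b h ↦ ⟨0, ?_⟩
    · exact IsUnit.of_mul_eq_one ⟨_, hRT heinv⟩ (Subtype.ext (mul_inv_cancel₀ hE0))
    · obtain ⟨n, a, h⟩ := hden s.2
      exact ⟨n, a, Subtype.ext h⟩
    · have hab : algebraMap (𝓞 K) K a = algebraMap (𝓞 K) K b :=
        congrArg (fun r : (NumberRing.associatedSet R).integer K ↦ (r : K)) h
      rw [FaithfulSMul.algebraMap_injective (𝓞 K) K hab]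
  · refine Set.Subset.antisymm (fun x hx ↦ ?_) fun x hx ↦ ?_
    · have hxR : x ∈ R := by simpa using hx 1 (one_mem _)
      obtain ⟨n, a, h⟩ := hden (hRT hxR)
      -- Multiplying by `ε ^ n ∈ R` keeps `x` in the conductor of `R` and makes it integral; `ε⁻ⁿ ∈
      -- 𝔬_{K,T}` then recovers `x`.
      have hmem : algebraMap (𝓞 K) K a ∈
          NumberRing.conductor (NumberRing.integralPart R) := by
        rw [hcond]
        refine ⟨fun y hy ↦ ?_, a, rfl⟩
        rw [← h, mul_right_comm]
        exact mul_mem (hx y hy) (pow_mem heR n)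
      have hxe : x = (⟨_, hRT (pow_mem heinv n)⟩ : (NumberRing.associatedSet R).integer K) •
          algebraMap (𝓞 K) K a := by
        rw [Subalgebra.smul_def, smul_eq_mul, ← h]
        change x = (algebraMap (𝓞 K) K e)⁻¹ ^ n * (x * algebraMap (𝓞 K) K e ^ n)
        rw [inv_pow]
        field_simp
      rw [hxe]
      exact Submodule.smul_mem _ _ (Submodule.subset_span hmem)
    · induction hx using Submodule.span_induction with
      | mem x h => rw [hcond] at h; exact h.1
      | zero => intro y _; rw [zero_mul]; exact zero_mem R
      | add x y _ _ hx hy => intro z hz; rw [add_mul]; exact add_mem (hx z hz) (hy z hz)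
      | smul c x _ hx =>
        intro z hz
        rw [Subalgebra.smul_def, smul_eq_mul, mul_comm (c : K), mul_assoc]
        exact hx _ (mul_mem (hTO c.2) hz)
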